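/- **Setting.** Let $\mathcal K$ be a complex Hilbert space of finite or infinite dimension. A *state* on $\mathcal K$ is a positive trace class operator with trace one. Let $\rho,\sigma$ be states with spectral decompositions $$\rho=\sum_{i\in I} r_i\,|u_i\rangle\langle u_i|,\qquad \sigma=\sum_{j\in I}s_j\,|v_j\rangle\langle v_j|,$$ where $(u_i)_{i\in I}$ and $(v_j)_{j\in I}$ are orthonormal bases of $\mathcal K$, $r_i,s_j\ge 0$ and $\sum_i r_i=\sum_j s_j=1$. Their Nussbaum–Szkoła distributions are the probability distributions on $I\times I$ $$P(i,j)=r_i|\langle u_i,v_j\rangle|^2,\qquad Q(i,j)=s_j|\langle u_i,v_j\rangle|^2 .$$ For a convex or concave $f:(0,\infty)\to\mathbb R$ put $f(0)=\lim_{t\downarrow0}f(t)$ and $f'(\infty)=\lim_{t\to\infty}f(t)/t$, both in $[-\infty,\infty]$, with the conventions $0\cdot(\pm\infty)=0$, $0f(0/0)=0$ and $0f(a/0)=a f'(\infty)$ for $a>0$. The classical $f$-divergence is $$D_f(P\|Q)=\sum_{(i,j)\in I\times I}Q(i,j)\,f\!\left(\frac{P(i,j)}{Q(i,j)}\right)\in[-\infty,\infty].$$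 Let $\mathcal B_2(\mathcal K)$ be the Hilbert space of Hilbert–Schmidt operators with $\langle A,B\rangle_2=\operatorname{tr}(A^\dagger B)$, let $\Pi_\eta$ be the orthogonal projection onto the support $(\ker\eta)^\perp$ of a state $\eta$, and $\Pi_\eta^\perp=1-\Pi_\eta$. Let $S$ be the densely defined closable antilinear operator on $\mathcal B_2(\mathcal K)$ with $$S\big(X\sqrt\sigma+Y(1-\Pi_\sigma)\big)=\Pi_\sigma X^\dagger\sqrt\rho,\qquad X\in\mathcal B(\mathcal K),\ Y\in\mathcal B_2(\mathcal K),$$ let $\Delta_{\rho,\sigma}=S^\dagger\overline S$ be the relative modular operator (a positive self-adjoint operator), and $\xi^{\Delta_{\rho,\sigma}}$ its spectral measure. The quantum $f$-divergence is $$D_f(\rho\|\sigma)=\int_{(0,\infty)}f(\lambda)\,\langle\sqrt\sigma,\xi^{\Delta_{\rho,\sigma}}(d\lambda)\sqrt\sigma\rangle_2+f(0)\operatorname{tr}(\sigma\Pi_\rho^\perp)+f'(\infty)\operatorname{tr}(\rho\Pi_\sigma^\perp)\in[-\infty,\infty].$$ **Theorem.** For all states $\rho,\sigma$ with spectral decompositions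 as above and every convex or concave $f:(0,\infty)\to\mathbb R$, $$D_f(\rho\|\sigma)=D_f(P\|Q).$$ -/

import Mathlib

noncomputable section

open MeasureTheory Filter Topology Set
open scoped InnerProductSpace ENNReal

namespace NussbaumSzkola

/-! ### Extended-real valued integrals and sums -/

/-- The integral of an extended-real valued function, `∫ g⁺ - ∫ g⁻`.  It has its usual meaning
as soon as one of the two parts has a finite integral. -/
def erealIntegral {α : Type*} [MeasurableSpace α] (μ : Measure α) (g : α → EReal) : EReal :=
  ((∫⁻ a, (g a).toENNReal ∂μ : ℝ≥0∞) : EReal) - ((∫⁻ a, (-(g a)).toENNReal ∂μ : ℝ≥0∞) : EReal)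

/-- The unordered sum of a family of extended reals, `∑ g⁺ - ∑ g⁻`.  It has its usual meaning
as soon as one of the two parts has a finite sum. -/
def erealSum {α : Type*} (g : α → EReal) : EReal :=
  ((∑' a, (g a).toENNReal : ℝ≥0∞) : EReal) - ((∑' a, (-(g a)).toENNReal : ℝ≥0∞) : EReal)

/-! ### Boundary values of a function on `(0, ∞)`

A function `f : (0, ∞) → ℝ` is given by a function on `ℝ` whose values outside `(0, ∞)`
are never used. -/

/-- `f(0) = lim_{t ↓ 0} f(t)`, in `[-∞, ∞]`. -/
def valueAtZero (f : ℝ → ℝ) : EReal := limUnder (𝓝[>] (0 : ℝ)) (fun t => (f t : EReal))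

/-- `f'(∞) = lim_{t → ∞} f(t) / t`, in `[-∞, ∞]`. -/
def slopeAtInfty (f : ℝ → ℝ) : EReal := limUnder atTop (fun t : ℝ => ((f t / t : ℝ) : EReal))

/-! ### Classical `f`-divergence of discrete distributions -/

/-- The term `q f(p / q)` for `p, q ≥ 0`, with the conventions `0 f(0/0) = 0`,
`0 f(p/0) = p f'(∞)` for `p > 0`, and `f(0) = lim_{t ↓ 0} f(t)`. -/
def divergenceTerm (f : ℝ → ℝ) (p q : ℝ) : EReal :=
  if q = 0 then (if p = 0 then 0 else (p : EReal) * slopeAtInfty f)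
  else if p = 0 then (q : EReal) * valueAtZero f
  else (q : EReal) * (f (p / q) : EReal)

/-- The `f`-divergence `D_f(P‖Q) = ∑ Q(a) f(P(a) / Q(a))` of discrete distributions. -/
def classicalFDivergence {α : Type*} (f : ℝ → ℝ) (P Q : α → ℝ) : EReal :=
  erealSum (fun a => divergenceTerm f (P a) (Q a))

/-! ### Projection-valued measures on the real line -/

section PVM

variable (H : Type*) [NormedAddCommGroup H] [InnerProductSpace ℂ H] [CompleteSpace H]

/-- A projection-valued measure on the Borel sets of `ℝ`: orthogonal projections, countably
additive in the strong operator topology, with total mass the identity.  The values on sets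
that are not Borel play no role. -/
structure ProjectionValuedMeasure where
  proj : Set ℝ → H →L[ℂ] H
  isStarProjection : ∀ E, MeasurableSet E → IsStarProjection (proj E)
  proj_univ : proj univ = 1
  hasSum_iUnion : ∀ E : ℕ → Set ℝ, (∀ n, MeasurableSet (E n)) → Pairwise (Function.onFun Disjoint E) →
    ∀ x : H, HasSum (fun n => proj (E n) x) (proj (⋃ n, E n) x)

variable {H}

theorem ProjectionValuedMeasure.re_inner_nonneg (ξ : ProjectionValuedMeasure H) {E : Set ℝ}
    (hE : MeasurableSet E) (x : H) : 0 ≤ (⟪x, ξ.proj E x⟫_ℂ).re := by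
  have h := ξ.isStarProjection E hE
  have h1 : ξ.proj E x = ξ.proj E (ξ.proj E x) := by
    conv_lhs => rw [← h.isIdempotentElem.eq]
    rfl
  have h2 : ⟪x, ξ.proj E x⟫_ℂ = ⟪ξ.proj E x, ξ.proj E x⟫_ℂ := by
    conv_lhs => rw [h1]
    rw [← ContinuousLinearMap.adjoint_inner_left, ← ContinuousLinearMap.star_eq_adjoint,
      h.isSelfAdjoint.star_eq]
  rw [h2]
  exact inner_self_nonneg (𝕜 := ℂ)

theorem ProjectionValuedMeasure.proj_empty (ξ : ProjectionValuedMeasure H) (x : H) :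
    ξ.proj ∅ x = 0 := by
  have h := ξ.hasSum_iUnion (fun _ => ∅) (fun _ => MeasurableSet.empty)
    (fun _ _ _ => disjoint_bot_left) x
  exact tendsto_nhds_unique tendsto_const_nhds h.summable.tendsto_atTop_zero

/-- The scalar measure `E ↦ ⟨x, ξ(E) x⟩` of a projection-valued measure. -/
def ProjectionValuedMeasure.scalarMeasure (ξ : ProjectionValuedMeasure H) (x : H) : Measure ℝ :=
  Measure.ofMeasurable (fun E _ => ENNReal.ofReal (⟪x, ξ.proj E x⟫_ℂ).re)
    (by simp [ξ.proj_empty])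
    (by
      intro E hE hd
      have h := ξ.hasSum_iUnion E hE hd x
      have h2 : HasSum (fun n => (⟪x, ξ.proj (E n) x⟫_ℂ).re)
          (⟪x, ξ.proj (⋃ n, E n) x⟫_ℂ).re :=
        Complex.hasSum_re (h.mapL (innerSL ℂ x))
      rw [← h2.tsum_eq]
      exact ENNReal.ofReal_tsum_of_nonneg (fun n => ξ.re_inner_nonneg (hE n) x) h2.summable)

/-- `ξ` is the spectral measure of the operator with graph `G`, i.e. `G` is the graph of
`∫ t dξ(t)`: a vector `x` lies in the domain iff `∫ t² d⟨x, ξ(t) x⟩ < ∞`, and then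
`⟨x, A x⟩ = ∫ t d⟨x, ξ(t) x⟩`.  (The off-diagonal matrix elements follow by polarization.) -/
structure IsSpectralMeasure (ξ : ProjectionValuedMeasure H) (G : Set (H × H)) : Prop where
  mem_domain_iff : ∀ x : H,
    (∃ y, (x, y) ∈ G) ↔ ∫⁻ t, ENNReal.ofReal (t ^ 2) ∂(ξ.scalarMeasure x) < ∞
  inner_eq_integral : ∀ x y : H, (x, y) ∈ G →
    ⟪x, y⟫_ℂ = ((∫ t, t ∂(ξ.scalarMeasure x) : ℝ) : ℂ)

/-- The projection-valued Dirac measure at `0`. -/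
instance : Nonempty (ProjectionValuedMeasure H) := by
  classical
  refine ⟨⟨fun E => if (0 : ℝ) ∈ E then 1 else 0, ?_, by simp, ?_⟩⟩
  · intro E _
    split_ifs
    · exact IsStarProjection.one _
    · exact IsStarProjection.zero _
  · intro E _ hd x
    by_cases h : (0 : ℝ) ∈ ⋃ n, E n
    · obtain ⟨n, hn⟩ := mem_iUnion.1 h
      simp only [h, if_true]
      have : (if (0 : ℝ) ∈ E n then (1 : H →L[ℂ] H) else 0) x = (1 : H →L[ℂ] H) x := by
        simp [hn]
      rw [← this]
      refine hasSum_single n fun m hm => ?_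
      have : (0 : ℝ) ∉ E m := fun h0 => Set.disjoint_left.1 (hd hm) h0 hn
      simp [this]
    · have h' : ∀ n, (0 : ℝ) ∉ E n := fun n hn => h (mem_iUnion.2 ⟨n, hn⟩)
      simp only [h, h', if_false]
      exact hasSum_zero

/-- The spectral measure of the self-adjoint operator with graph `G`.  (For a self-adjoint
operator it exists and is unique by the spectral theorem; for other `G` the value is
arbitrary.) -/
def spectralMeasure (G : Set (H × H)) : ProjectionValuedMeasure H :=
  Classical.epsilon (fun ξ => IsSpectralMeasure ξ G)

end PVM

/-! ### Hilbert–Schmidt operators and traces -/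

variable (K : Type*) [NormedAddCommGroup K] [InnerProductSpace ℂ K] [CompleteSpace K]

/-- The index set of a fixed orthonormal basis of `K`. -/
def StdIndex : Set K := (exists_hilbertBasis ℂ K).choose

/-- A fixed orthonormal basis of `K`.  The Hilbert–Schmidt inner product and the trace are
computed in it; they do not depend on the choice of the basis. -/
def stdBasis : HilbertBasis (StdIndex K) ℂ K := (exists_hilbertBasis ℂ K).choose_spec.choose

/-- The subspace of those bounded operators `A` with `∑ ‖A bᵢ‖² < ∞`. -/
def hilbertSchmidtSubmodule : Submodule ℂ (K →L[ℂ] K) where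
  carrier := {A | Summable fun i => ‖A (stdBasis K i)‖ ^ 2}
  zero_mem' := by simp [summable_zero]
  add_mem' := by
    intro A B hA hB
    refine Summable.of_nonneg_of_le (fun i => by positivity) (fun i => ?_)
      ((hA.add hB).mul_left 2)
    have h := norm_add_le (A (stdBasis K i)) (B (stdBasis K i))
    have h0 := norm_nonneg (A (stdBasis K i) + B (stdBasis K i))
    simp only [add_apply]
    nlinarith [sq_nonneg (‖A (stdBasis K i)‖ - ‖B (stdBasis K i)‖)]
  smul_mem' := by
    intro c A hA
    have : (fun i => ‖(c • A) (stdBasis K i)‖ ^ 2)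
        = fun i => ‖c‖ ^ 2 * ‖A (stdBasis K i)‖ ^ 2 := by
      funext i
      simp [norm_smul, mul_pow]
    change Summable fun i => ‖(c • A) (stdBasis K i)‖ ^ 2
    rw [this]
    exact Summable.mul_left _ hA

/-- The space `B₂(K)` of Hilbert–Schmidt operators on `K`. -/
@[ext]
structure HilbertSchmidt where
  op : K →L[ℂ] K
  mem : op ∈ hilbertSchmidtSubmodule K

variable {K}

namespace HilbertSchmidt

theorem op_injective : Function.Injective (op : HilbertSchmidt K → K →L[ℂ] K) :=
  fun _ _ h => HilbertSchmidt.ext h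

instance : Zero (HilbertSchmidt K) := ⟨⟨0, Submodule.zero_mem _⟩⟩
instance : Add (HilbertSchmidt K) := ⟨fun A B => ⟨A.op + B.op, Submodule.add_mem _ A.mem B.mem⟩⟩
instance : Neg (HilbertSchmidt K) := ⟨fun A => ⟨-A.op, Submodule.neg_mem _ A.mem⟩⟩
instance : Sub (HilbertSchmidt K) := ⟨fun A B => ⟨A.op - B.op, Submodule.sub_mem _ A.mem B.mem⟩⟩
instance : SMul ℂ (HilbertSchmidt K) := ⟨fun c A => ⟨c • A.op, Submodule.smul_mem _ c A.mem⟩⟩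
instance : SMul ℕ (HilbertSchmidt K) := ⟨fun n A => ⟨n • A.op, nsmul_mem A.mem n⟩⟩
instance : SMul ℤ (HilbertSchmidt K) := ⟨fun n A => ⟨n • A.op, zsmul_mem A.mem n⟩⟩

instance : AddCommGroup (HilbertSchmidt K) :=
  op_injective.addCommGroup op rfl (fun _ _ => rfl) (fun _ => rfl) (fun _ _ => rfl)
    (fun _ _ => rfl) (fun _ _ => rfl)

/-- The inclusion of `B₂(K)` into the bounded operators, as an additive map. -/
def opHom : HilbertSchmidt K →+ (K →L[ℂ] K) where
  toFun := op
  map_zero' := rfl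
  map_add' _ _ := rfl

instance : Module ℂ (HilbertSchmidt K) :=
  op_injective.module ℂ opHom (fun _ _ => rfl)

/-- The square-summable family `(A bᵢ)ᵢ`. -/
def toLp (A : HilbertSchmidt K) : lp (fun _ : StdIndex K => K) 2 :=
  ⟨fun i => A.op (stdBasis K i), by
    refine memℓp_gen ?_
    have h : Summable fun i => ‖A.op (stdBasis K i)‖ ^ 2 := A.mem
    simpa using h⟩

theorem summable_inner (A B : HilbertSchmidt K) :
    Summable fun i => ⟪A.op (stdBasis K i), B.op (stdBasis K i)⟫_ℂ :=
  lp.summable_inner (𝕜 := ℂ) A.toLp B.toLp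

/-- The Hilbert–Schmidt inner product `⟨A, B⟩₂ = tr(A† B) = ∑ ⟨A bᵢ, B bᵢ⟩`. -/
instance : Inner ℂ (HilbertSchmidt K) :=
  ⟨fun A B => ∑' i, ⟪A.op (stdBasis K i), B.op (stdBasis K i)⟫_ℂ⟩

theorem inner_def (A B : HilbertSchmidt K) :
    ⟪A, B⟫_ℂ = ∑' i, ⟪A.op (stdBasis K i), B.op (stdBasis K i)⟫_ℂ := rfl

theorem inner_eq_toLp (A B : HilbertSchmidt K) : ⟪A, B⟫_ℂ = ⟪A.toLp, B.toLp⟫_ℂ := rfl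

theorem toLp_add (A B : HilbertSchmidt K) : (A + B).toLp = A.toLp + B.toLp := rfl

theorem toLp_sub (A B : HilbertSchmidt K) : (A - B).toLp = A.toLp - B.toLp := rfl

theorem toLp_smul (c : ℂ) (A : HilbertSchmidt K) : (c • A).toLp = c • A.toLp := rfl

/-- An operator is bounded by its Hilbert–Schmidt norm. -/
theorem norm_op_apply_le (A : HilbertSchmidt K) (y : K) : ‖A.op y‖ ≤ ‖A.toLp‖ * ‖y‖ := by
  have h1 : HasSum (fun i => (stdBasis K).repr y i • A.op (stdBasis K i)) (A.op y) := by
    simpa using ((stdBasis K).hasSum_repr y).mapL A.op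
  refine le_of_tendsto h1.norm (Eventually.of_forall fun s => ?_)
  have hA : ∑ i ∈ s, ‖A.op (stdBasis K i)‖ ^ 2 ≤ ‖A.toLp‖ ^ 2 := by
    have h := lp.sum_rpow_le_norm_rpow (p := 2) (by simp) A.toLp s
    simp only [ENNReal.toReal_ofNat, Real.rpow_ofNat] at h
    exact h
  have hy : ∑ i ∈ s, ‖(stdBasis K).repr y i‖ ^ 2 ≤ ‖y‖ ^ 2 := by
    simpa [HilbertBasis.repr_apply_apply] using
      (stdBasis K).orthonormal.sum_inner_products_le y (s := s)
  refine (norm_sum_le _ _).trans ?_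
  refine abs_le_of_sq_le_sq' ?_ (by positivity) |>.2
  simp only [norm_smul]
  refine (Finset.sum_mul_sq_le_sq_mul_sq s _ _).trans ?_
  rw [mul_pow, mul_comm]
  gcongr

theorem toLp_injective : Function.Injective (toLp : HilbertSchmidt K → _) := by
  intro A B h
  have h0 : (A - B).toLp = 0 := by rw [toLp_sub, h, sub_self]
  refine op_injective (ContinuousLinearMap.ext fun y => ?_)
  have := norm_op_apply_le (A - B) y
  rw [h0, norm_zero, zero_mul] at this
  exact sub_eq_zero.1 (norm_le_zero_iff.1 this)

/-- The axioms of the Hilbert–Schmidt inner product. -/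
@[reducible]
def core : InnerProductSpace.Core ℂ (HilbertSchmidt K) where
  inner A B := ⟪A, B⟫_ℂ
  conj_inner_symm A B := inner_conj_symm A.toLp B.toLp
  re_inner_nonneg A := inner_self_nonneg (𝕜 := ℂ) (x := A.toLp)
  add_left A B C := inner_add_left A.toLp B.toLp C.toLp
  smul_left A B c := inner_smul_left A.toLp B.toLp c
  definite A h := toLp_injective (inner_self_eq_zero.1 (h : ⟪A.toLp, A.toLp⟫_ℂ = 0))

instance : NormedAddCommGroup (HilbertSchmidt K) :=
  InnerProductSpace.Core.toNormedAddCommGroup (cd := core)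

instance : InnerProductSpace ℂ (HilbertSchmidt K) := InnerProductSpace.ofCore core.toCore

theorem norm_eq (A : HilbertSchmidt K) : ‖A‖ = ‖A.toLp‖ := by
  rw [norm_eq_sqrt_re_inner (𝕜 := ℂ) A.toLp]
  exact norm_eq_sqrt_re_inner (𝕜 := ℂ) A

theorem isometry_toLp : Isometry (toLp : HilbertSchmidt K → _) :=
  Isometry.of_dist_eq fun A B => by rw [dist_eq_norm, dist_eq_norm, ← toLp_sub, norm_eq]

instance : CompleteSpace (HilbertSchmidt K) := by
  refine Metric.complete_of_cauchySeq_tendsto fun u hu => ?_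
  obtain ⟨x, hx⟩ := cauchySeq_tendsto_of_complete
    (isometry_toLp.uniformContinuous.comp_cauchySeq hu)
  have hl : LipschitzWith 1 (op : HilbertSchmidt K → K →L[ℂ] K) := by
    refine LipschitzWith.of_dist_le_mul fun A B => ?_
    rw [dist_eq_norm, dist_eq_norm, norm_eq, NNReal.coe_one, one_mul]
    exact ContinuousLinearMap.opNorm_le_bound _ (norm_nonneg _) (norm_op_apply_le (A - B))
  obtain ⟨A, hA⟩ := cauchySeq_tendsto_of_complete (hl.uniformContinuous.comp_cauchySeq hu)
  have hAx : ∀ i, A (stdBasis K i) = x i := by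
    intro i
    refine tendsto_nhds_unique (f := fun n => (u n).op (stdBasis K i)) (l := atTop) ?_ ?_
    · exact ((ContinuousLinearMap.apply ℂ K (stdBasis K i)).continuous.tendsto A).comp hA
    · have h1 : Tendsto (fun n => (⇑(u n).toLp : StdIndex K → K)) atTop (𝓝 ⇑x) :=
        (lp.uniformContinuous_coe (p := 2)).continuous.continuousAt.tendsto.comp hx
      exact (tendsto_pi_nhds.1 h1) i
  have hm : A ∈ hilbertSchmidtSubmodule K := by
    have h := (lp.memℓp x).summable (by simp)
    change Summable fun i => ‖A (stdBasis K i)‖ ^ 2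
    simpa [hAx] using h
  refine ⟨⟨A, hm⟩, ?_⟩
  have hxA : toLp ⟨A, hm⟩ = x := by
    ext i
    exact hAx i
  rw [isometry_toLp.isEmbedding.tendsto_nhds_iff, hxA]
  exact hx

end HilbertSchmidt

/-- The trace `∑ ⟨bᵢ, A bᵢ⟩`. It is used for trace class operators only. -/
def trace (A : K →L[ℂ] K) : ℂ := ∑' i, ⟪stdBasis K i, A (stdBasis K i)⟫_ℂ

variable (K) in
/-- A state: a positive operator with `∑ ⟨bᵢ, ρ bᵢ⟩ = 1`.  (A positive operator is of trace
class iff this series converges.) -/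
structure DensityOperator where
  op : K →L[ℂ] K
  isPositive : op.IsPositive
  hasSum_one : HasSum (fun i => ⟪stdBasis K i, op (stdBasis K i)⟫_ℂ) 1

namespace DensityOperator

/-- The positive square root `√ρ`. -/
def sqrt (ρ : DensityOperator K) : K →L[ℂ] K := CFC.sqrt ρ.op

/-- `√ρ` is a Hilbert–Schmidt operator. -/
theorem sqrt_mem (ρ : DensityOperator K) : ρ.sqrt ∈ hilbertSchmidtSubmodule K := by
  have h0 : 0 ≤ ρ.op := (ContinuousLinearMap.nonneg_iff_isPositive _).2 ρ.isPositive
  have hs : IsSelfAdjoint ρ.sqrt := IsSelfAdjoint.of_nonneg (CFC.sqrt_nonneg ρ.op)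
  have hsq : ρ.sqrt * ρ.sqrt = ρ.op := CFC.sqrt_mul_sqrt_self ρ.op h0
  have h : ∀ x, (⟪x, ρ.op x⟫_ℂ).re = ‖ρ.sqrt x‖ ^ 2 := by
    intro x
    rw [← hsq, mul_apply_eq_comp, ← ContinuousLinearMap.adjoint_inner_left,
      ← ContinuousLinearMap.star_eq_adjoint, hs.star_eq]
    exact inner_self_eq_norm_sq (𝕜 := ℂ) _
  change Summable fun i => ‖ρ.sqrt (stdBasis K i)‖ ^ 2
  simpa only [h] using (Complex.hasSum_re ρ.hasSum_one).summable

/-- `√ρ` as a vector of `B₂(K)`. -/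
def sqrtHS (ρ : DensityOperator K) : HilbertSchmidt K := ⟨ρ.sqrt, ρ.sqrt_mem⟩

/-- `Π_ρ^⊥`, the orthogonal projection onto `ker ρ`. -/
def kerProj (ρ : DensityOperator K) : K →L[ℂ] K := (ρ.op.ker).starProjection

/-- `Π_ρ`, the orthogonal projection onto the support `(ker ρ)^⊥` of `ρ`. -/
def suppProj (ρ : DensityOperator K) : K →L[ℂ] K := (ρ.op.ker)ᗮ.starProjection

end DensityOperator

/-! ### The relative modular operator

The operators below are given by their graphs in `B₂(K) × B₂(K)`. -/

/-- The graph of the antilinear operator `S` with domain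
`{X √σ + Y (1 - Π_σ) : X ∈ B(K), Y ∈ B₂(K)}`, given by
`S (X √σ + Y (1 - Π_σ)) = Π_σ X† √ρ`. -/
def graphS (ρ σ : DensityOperator K) : Set (HilbertSchmidt K × HilbertSchmidt K) :=
  {p | ∃ (X : K →L[ℂ] K) (Y : HilbertSchmidt K),
    p.1.op = X * σ.sqrt + Y.op * (1 - σ.suppProj) ∧
    p.2.op = σ.suppProj * ContinuousLinearMap.adjoint X * ρ.sqrt}

/-- The graph of the adjoint of the antilinear operator with graph `G`: the pairs `(a, c)` with
`⟨a, S b⟩ = conj ⟨c, b⟩` for all `b` in the domain of `S`. -/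
def antilinearAdjointGraph {H : Type*} [NormedAddCommGroup H] [InnerProductSpace ℂ H]
    (G : Set (H × H)) : Set (H × H) :=
  {q | ∀ p ∈ G, ⟪q.1, p.2⟫_ℂ = starRingEnd ℂ ⟪q.2, p.1⟫_ℂ}

/-- The graph of the relative modular operator `Δ_{ρ,σ} = S† S̄`, where `S̄` is the closure
of `S`. -/
def relativeModularGraph (ρ σ : DensityOperator K) : Set (HilbertSchmidt K × HilbertSchmidt K) :=
  {p | ∃ b, (p.1, b) ∈ closure (graphS ρ σ) ∧ (b, p.2) ∈ antilinearAdjointGraph (graphS ρ σ)}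

/-! ### Quantum `f`-divergence -/

/-- `D_f(ρ‖σ) = ∫_{(0,∞)} f(t) ⟨√σ, ξ(dt) √σ⟩₂ + f(0) tr(σ Π_ρ^⊥) + f'(∞) tr(ρ Π_σ^⊥)`, where `ξ`
is the spectral measure of `Δ_{ρ,σ}`. -/
def quantumFDivergence (f : ℝ → ℝ) (ρ σ : DensityOperator K) : EReal :=
  erealIntegral
      (((spectralMeasure (relativeModularGraph ρ σ)).scalarMeasure σ.sqrtHS).restrict (Ioi 0))
      (fun t => (f t : EReal))
    + valueAtZero f * ((trace (σ.op * ρ.kerProj)).re : EReal)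
    + slopeAtInfty f * ((trace (ρ.op * σ.kerProj)).re : EReal)

/-! ### Nussbaum–Szkoła distributions -/

/-- The spectral decomposition `ρ = ∑ rᵢ |uᵢ⟩⟨uᵢ|`, `rᵢ ≥ 0`, `∑ rᵢ = 1`, in the orthonormal
basis `u`. -/
structure IsSpectralDecomposition {ι : Type*} (ρ : DensityOperator K) (r : ι → ℝ)
    (u : HilbertBasis ι ℂ K) : Prop where
  nonneg : ∀ i, 0 ≤ r i
  hasSum_one : HasSum r 1
  hasSum_apply : ∀ x, HasSum (fun i => (r i : ℂ) • ⟪u i, x⟫_ℂ • u i) (ρ.op x)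

/-- `P(i, j) = rᵢ |⟨uᵢ, vⱼ⟩|²`. -/
def nussbaumSzkolaP {ι : Type*} (r : ι → ℝ) (u v : HilbertBasis ι ℂ K) (a : ι × ι) : ℝ :=
  r a.1 * ‖⟪u a.1, v a.2⟫_ℂ‖ ^ 2

/-- `Q(i, j) = sⱼ |⟨uᵢ, vⱼ⟩|²`. -/
def nussbaumSzkolaQ {ι : Type*} (s : ι → ℝ) (u v : HilbertBasis ι ℂ K) (a : ι × ι) : ℝ :=
  s a.2 * ‖⟪u a.1, v a.2⟫_ℂ‖ ^ 2

end NussbaumSzkola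

end

/-!
In the orthonormal basis `|uᵢ⟩⟨vⱼ|` of the Hilbert–Schmidt operators, the closure of `S` is the
antilinear diagonal operator `|uᵢ⟩⟨vⱼ| ↦ √(rᵢ / sⱼ) |vⱼ⟩⟨uᵢ|` (with value `0` where `sⱼ = 0`). Hence
`Δ = S†S` is diagonal with eigenvalues `rᵢ / sⱼ`, and its spectral measure in the vector `√σ` is
`∑ Q(i, j) δ_{rᵢ / sⱼ}`. So the integral over `(0, ∞)` is the part of `∑ Q f(P / Q)` where `P` and
`Q` are both positive, and the traces `tr(σ Π_ρ^⊥)` and `tr(ρ Π_σ^⊥)` are the masses of `Q` on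
`{P = 0}` and of `P` on `{Q = 0}`.
-/

noncomputable section

open MeasureTheory Filter Topology Set
open scoped InnerProductSpace ENNReal

namespace NussbaumSzkola

/-! ### Expansions in a Hilbert basis -/

section HilbertBasis

variable {𝕜 H α : Type*} [RCLike 𝕜] [NormedAddCommGroup H] [InnerProductSpace 𝕜 H]

theorem ext_inner_hilbertBasis (e : HilbertBasis α 𝕜 H) {x y : H}
    (h : ∀ a, ⟪e a, x⟫_𝕜 = ⟪e a, y⟫_𝕜) : x = y := by
  apply e.repr.injective
  ext a
  simpa only [e.repr_apply_apply] using h a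

theorem hasSum_inner_smul (e : HilbertBasis α 𝕜 H) (x : H) :
    HasSum (fun a => ⟪e a, x⟫_𝕜 • e a) x := by
  simpa only [e.repr_apply_apply] using e.hasSum_repr x

theorem hasSum_norm_inner_sq (e : HilbertBasis α 𝕜 H) (x : H) :
    HasSum (fun a => ‖⟪e a, x⟫_𝕜‖ ^ 2) (‖x‖ ^ 2) := by
  have h := RCLike.hasSum_re 𝕜 (e.hasSum_inner_mul_inner x x)
  simp only [inner_self_eq_norm_sq, inner_mul_symm_re_eq_norm, norm_mul,
    norm_inner_symm x (e _)] at h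
  simpa only [sq] using h

theorem tsum_ofReal_norm_inner_sq (e : HilbertBasis α 𝕜 H) (x : H) :
    ∑' a, ENNReal.ofReal (‖⟪e a, x⟫_𝕜‖ ^ 2) = ENNReal.ofReal (‖x‖ ^ 2) := by
  have h := hasSum_norm_inner_sq e x
  rw [← h.tsum_eq, ENNReal.ofReal_tsum_of_nonneg (fun a => by positivity) h.summable]

theorem exists_forall_inner_eq (e : HilbertBasis α 𝕜 H) {c : α → 𝕜}
    (hc : Summable fun a => ‖c a‖ ^ 2) : ∃ y : H, ∀ a, ⟪e a, y⟫_𝕜 = c a := by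
  refine ⟨e.repr.symm ⟨c, memℓp_gen (by simpa using hc)⟩, fun a => ?_⟩
  rw [← e.repr_apply_apply, LinearIsometryEquiv.apply_symm_apply]

theorem continuousLinearMap_ext_hilbertBasis {F : Type*} [NormedAddCommGroup F] [NormedSpace 𝕜 F]
    (e : HilbertBasis α 𝕜 H) {A B : H →L[𝕜] F} (h : ∀ a, A (e a) = B (e a)) : A = B := by
  ext x
  have hA := (hasSum_inner_smul e x).mapL A
  have hB := (hasSum_inner_smul e x).mapL B
  simp only [map_smul, h] at hA hB
  exact hA.unique hB

variable [CompleteSpace H]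

/-- The orthogonal projection onto the closed span of the basis vectors with index in `T`. -/
def basisProj (e : HilbertBasis α 𝕜 H) (T : Set α) : H →L[𝕜] H :=
  (Submodule.span 𝕜 (e '' T)).topologicalClosure.starProjection

theorem isStarProjection_basisProj (e : HilbertBasis α 𝕜 H) (T : Set α) :
    IsStarProjection (basisProj e T) := isStarProjection_starProjection

theorem basisProj_apply_basis (e : HilbertBasis α 𝕜 H) (T : Set α) (a : α) :
    basisProj e T (e a) = T.indicator e a := by
  by_cases ha : a ∈ T
  · rw [indicator_of_mem ha, basisProj, Submodule.starProjection_eq_self_iff]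
    exact Submodule.le_topologicalClosure _ (Submodule.subset_span ⟨a, ha, rfl⟩)
  · rw [indicator_of_notMem ha, basisProj, Submodule.starProjection_apply_eq_zero_iff,
      Submodule.orthogonal_closure, ← Submodule.span_singleton_le_iff_mem,
      ← Submodule.isOrtho_iff_le, Submodule.isOrtho_comm, Submodule.isOrtho_span]
    rintro _ ⟨b, hb, rfl⟩ _ rfl
    exact e.orthonormal.2 fun h => ha (h ▸ hb)

theorem inner_basisProj (e : HilbertBasis α 𝕜 H) (T : Set α) (x : H) (a : α) :
    ⟪e a, basisProj e T x⟫_𝕜 = T.indicator (fun a => ⟪e a, x⟫_𝕜) a := by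
  rw [basisProj, ← Submodule.inner_starProjection_left_eq_right, ← basisProj,
    basisProj_apply_basis]
  by_cases ha : a ∈ T <;> simp [ha]

theorem hasSum_basisProj (e : HilbertBasis α 𝕜 H) (T : Set α) (x : H) :
    HasSum (fun a : T => ⟪e a, x⟫_𝕜 • e a) (basisProj e T x) := by
  have h := hasSum_inner_smul e (basisProj e T x)
  simp only [inner_basisProj, ← indicator_smul_left] at h
  exact hasSum_subtype_iff_indicator.2 h

theorem hasSum_basisProj_iUnion (e : HilbertBasis α 𝕜 H) (T : ℕ → Set α)
    (hT : Pairwise (Function.onFun Disjoint T)) (x : H) :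
    HasSum (fun n => basisProj e (T n) x) (basisProj e (⋃ n, T n) x) := by
  have h := hasSum_basisProj e (⋃ n, T n) x
  rw [← (Set.unionEqSigmaOfDisjoint hT).symm.hasSum_iff] at h
  exact h.sigma fun n => hasSum_basisProj e (T n) x

end HilbertBasis

/-! ### Projection-valued measures -/

namespace ProjectionValuedMeasure

variable {H : Type*} [NormedAddCommGroup H] [InnerProductSpace ℂ H] [CompleteSpace H]
  (ξ : ProjectionValuedMeasure H) {E F : Set ℝ}

open scoped Classical in
/-- The `H`-valued measure `E ↦ ξ(E) x`, extended by zero to the sets that are not Borel. -/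
def vectorMeasure (x : H) : VectorMeasure ℝ H where
  measureOf' E := if MeasurableSet E then ξ.proj E x else 0
  empty' := by simp [ξ.proj_empty]
  not_measurable' _ hE := if_neg hE
  m_iUnion' E hE hd := by
    simpa only [hE, MeasurableSet.iUnion hE, if_true] using ξ.hasSum_iUnion E hE hd x

theorem vectorMeasure_apply (hE : MeasurableSet E) (x : H) :
    ξ.vectorMeasure x E = ξ.proj E x := if_pos hE

theorem proj_union (hE : MeasurableSet E) (hF : MeasurableSet F) (hEF : Disjoint E F) :
    ξ.proj (E ∪ F) = ξ.proj E + ξ.proj F := by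
  ext x
  simpa only [ξ.vectorMeasure_apply, hE, hF, hE.union hF] using!
    (ξ.vectorMeasure x).of_union hEF hE hF

theorem proj_add_proj_compl (hE : MeasurableSet E) : ξ.proj E + ξ.proj Eᶜ = 1 := by
  rw [← ξ.proj_union hE hE.compl disjoint_compl_right, union_compl_self, ξ.proj_univ]

theorem proj_mul_proj_of_disjoint (hE : MeasurableSet E) (hF : MeasurableSet F)
    (hEF : Disjoint E F) : ξ.proj E * ξ.proj F = 0 := by
  have hE' := (ξ.isStarProjection E hE).isIdempotentElem
  have hF' := (ξ.isStarProjection F hF).isIdempotentElem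
  have hU := (ξ.isStarProjection (E ∪ F) (hE.union hF)).isIdempotentElem
  rw [ξ.proj_union hE hF hEF] at hU
  have := IsAddTorsionFree.of_isTorsionFree ℂ (H →L[ℂ] H)
  exact hE'.mul_eq_zero_of_anticommute ((hE'.add_iff hF').1 hU)

theorem proj_mul_proj (hE : MeasurableSet E) (hF : MeasurableSet F) :
    ξ.proj E * ξ.proj F = ξ.proj (E ∩ F) := by
  have hE_split : ξ.proj E = ξ.proj (E ∩ F) + ξ.proj (E \ F) := by
    rw [← ξ.proj_union (hE.inter hF) (hE.diff hF)
      (disjoint_sdiff_right.mono_left inter_subset_right), inter_union_sdiff]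
  have hF_split : ξ.proj F = ξ.proj (E ∩ F) + ξ.proj (F \ E) := by
    rw [← ξ.proj_union (hE.inter hF) (hF.diff hE)
      (disjoint_sdiff_right.mono_left inter_subset_left), inter_comm, inter_union_sdiff]
  rw [hE_split, add_mul, ξ.proj_mul_proj_of_disjoint (hE.diff hF) hF disjoint_sdiff_left, add_zero,
    hF_split, mul_add, (ξ.isStarProjection _ (hE.inter hF)).isIdempotentElem.eq,
    ξ.proj_mul_proj_of_disjoint (hE.inter hF) (hF.diff hE)
      (disjoint_sdiff_right.mono_left inter_subset_left), add_zero]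

theorem inner_proj_left (hE : MeasurableSet E) (x y : H) :
    ⟪ξ.proj E x, y⟫_ℂ = ⟪x, ξ.proj E y⟫_ℂ :=
  (ξ.isStarProjection E hE).isSelfAdjoint.isSymmetric x y

theorem inner_proj_self (hE : MeasurableSet E) (x : H) :
    ⟪ξ.proj E x, x⟫_ℂ = ((‖ξ.proj E x‖ ^ 2 : ℝ) : ℂ) := by
  have hidem : ξ.proj E (ξ.proj E x) = ξ.proj E x :=
    congr($((ξ.isStarProjection E hE).isIdempotentElem.eq) x)
  rw [← hidem, ξ.inner_proj_left hE, hidem, inner_self_eq_norm_sq_to_K]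
  norm_cast

theorem scalarMeasure_apply (hE : MeasurableSet E) (x : H) :
    ξ.scalarMeasure x E = ENNReal.ofReal (‖ξ.proj E x‖ ^ 2) := by
  rw [scalarMeasure, Measure.ofMeasurable_apply E hE, ← ξ.inner_proj_left hE,
    ξ.inner_proj_self hE, Complex.ofReal_re]

instance (x : H) : IsFiniteMeasure (ξ.scalarMeasure x) :=
  ⟨by rw [ξ.scalarMeasure_apply MeasurableSet.univ]; exact ENNReal.ofReal_lt_top⟩

theorem scalarMeasure_proj_add_smul_proj_compl (hE : MeasurableSet E) (x : H) (c : ℂ) :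
    ξ.scalarMeasure (ξ.proj E x + c • ξ.proj Eᶜ x) = (ξ.scalarMeasure x).restrict E +
      ENNReal.ofReal (‖c‖ ^ 2) • (ξ.scalarMeasure x).restrict Eᶜ := by
  ext F hF
  have hproj : ξ.proj F (ξ.proj E x + c • ξ.proj Eᶜ x) =
      ξ.proj (F ∩ E) x + c • ξ.proj (F ∩ Eᶜ) x := by
    rw [map_add, map_smul, ← ξ.proj_mul_proj hF hE, ← ξ.proj_mul_proj hF hE.compl]
    rfl
  have hortho : ⟪ξ.proj (F ∩ E) x, c • ξ.proj (F ∩ Eᶜ) x⟫_ℂ = 0 := by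
    rw [ξ.inner_proj_left (hF.inter hE), map_smul, ← mul_apply_eq_comp,
      ξ.proj_mul_proj_of_disjoint (hF.inter hE) (hF.inter hE.compl)
        (disjoint_compl_right.mono inter_subset_right inter_subset_right)]
    simp
  have hpythagoras := norm_add_sq_eq_norm_sq_add_norm_sq_of_inner_eq_zero _ _ hortho
  rw [Measure.add_apply, Measure.smul_apply, Measure.restrict_apply hF, Measure.restrict_apply hF,
    ξ.scalarMeasure_apply hF, ξ.scalarMeasure_apply (hF.inter hE),
    ξ.scalarMeasure_apply (hF.inter hE.compl), smul_eq_mul, ← ENNReal.ofReal_mul (by positivity),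
    ← ENNReal.ofReal_add (by positivity) (by positivity), hproj, ← mul_pow, ← norm_smul]
  simpa only [sq] using congrArg ENNReal.ofReal hpythagoras

theorem scalarMeasure_proj (hE : MeasurableSet E) (x : H) :
    ξ.scalarMeasure (ξ.proj E x) = (ξ.scalarMeasure x).restrict E := by
  simpa using ξ.scalarMeasure_proj_add_smul_proj_compl hE x 0

theorem scalarMeasure_proj_add_unit_smul_proj_compl (hE : MeasurableSet E) (x : H) {c : ℂ}
    (hc : ‖c‖ = 1) :
    ξ.scalarMeasure (ξ.proj E x + c • ξ.proj Eᶜ x) = ξ.scalarMeasure x := by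
  rw [ξ.scalarMeasure_proj_add_smul_proj_compl hE, hc, one_pow, ENNReal.ofReal_one, one_smul,
    Measure.restrict_add_restrict_compl hE]

theorem scalarMeasure_eq_sum_dirac {α : Type*} (e : HilbertBasis α ℂ H) (l : α → ℝ)
    (h : ∀ E, MeasurableSet E → ∀ x a, ⟪e a, ξ.proj E x⟫_ℂ =
      (l ⁻¹' E).indicator (fun a => ⟪e a, x⟫_ℂ) a) (x : H) :
    ξ.scalarMeasure x =
      Measure.sum fun a => ENNReal.ofReal (‖⟪e a, x⟫_ℂ‖ ^ 2) • Measure.dirac (l a) := by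
  ext E hE
  rw [ξ.scalarMeasure_apply hE, ← tsum_ofReal_norm_inner_sq e, Measure.sum_apply _ hE]
  refine tsum_congr fun a => ?_
  rw [h E hE]
  by_cases ha : l a ∈ E <;> simp [ha]

end ProjectionValuedMeasure

/-! ### The spectral measure of a diagonal operator -/

section SpectralMeasure

variable {H α : Type*} [NormedAddCommGroup H] [InnerProductSpace ℂ H]

/-- The graph of the maximal operator that is diagonal in the basis `e` with entries `l`. -/
def diagonalGraph (e : HilbertBasis α ℂ H) (l : α → ℝ) : Submodule ℂ (H × H) where
  carrier := {p | ∀ a, ⟪e a, p.2⟫_ℂ = l a * ⟪e a, p.1⟫_ℂ}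
  zero_mem' a := by simp
  add_mem' hp hq a := by simp [hp a, hq a, mul_add]
  smul_mem' c p hp a := by simp [hp a, mul_left_comm]

theorem mk_mem_diagonalGraph {e : HilbertBasis α ℂ H} {l : α → ℝ} {x y : H} :
    (x, y) ∈ diagonalGraph e l ↔ ∀ a, ⟪e a, y⟫_ℂ = l a * ⟪e a, x⟫_ℂ := Iff.rfl

theorem hilbertBasis_mem_diagonalGraph (e : HilbertBasis α ℂ H) (l : α → ℝ) (a : α) :
    (e a, (l a : ℂ) • e a) ∈ diagonalGraph e l := fun b => by
  classical
  rw [inner_smul_right, orthonormal_iff_ite.1 e.orthonormal b a]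
  split_ifs with h
  · rw [h]
  · simp

variable [CompleteSpace H]

theorem integrable_id_of_lintegral_sq_lt_top {μ : Measure ℝ} [IsFiniteMeasure μ]
    (h : ∫⁻ t, ENNReal.ofReal (t ^ 2) ∂μ < ∞) : Integrable (fun t : ℝ => t) μ := by
  refine MemLp.integrable (q := 2) (by norm_num) ((memLp_two_iff_integrable_sq (by fun_prop)).2 ?_)
  exact ⟨by fun_prop, (hasFiniteIntegral_iff_ofReal (ae_of_all _ fun t => sq_nonneg t)).2 h⟩

theorem eq_zero_of_unit_mul_add_conj_mul_eq {w w' : ℂ}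
    (h : ∀ c : ℂ, ‖c‖ = 1 → c * w + starRingEnd ℂ c * w' = w + w') : w = 0 := by
  have hneg := h (-1) (by simp)
  have hI := h Complex.I (by simp)
  simp only [map_neg, map_one, Complex.conj_I] at hneg hI
  linear_combination (-(1 / 4 : ℂ) + Complex.I / 4) * hneg - (Complex.I / 2) * hI +
    (1 / 2 : ℂ) * (w - w') * Complex.I_sq

/-- Polarization: the spectral measure is tested against the vectors `ξ(E) x + c ξ(Eᶜ) x` with
`|c| = 1`, all of which have the same scalar measure. -/
theorem IsSpectralMeasure.inner_proj_eq_setIntegral {G : Submodule ℂ (H × H)}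
    {ξ : ProjectionValuedMeasure H} (hξ : IsSpectralMeasure ξ G) {x x' : H} (hx : (x, x') ∈ G)
    {E : Set ℝ} (hE : MeasurableSet E) :
    ⟪ξ.proj E x, x'⟫_ℂ = ((∫ t in E, t ∂(ξ.scalarMeasure x) : ℝ) : ℂ) := by
  set y := ξ.proj E x
  set z := ξ.proj Eᶜ x
  have hyz : y + z = x := congr($(ξ.proj_add_proj_compl hE) x)
  obtain ⟨y', hy⟩ : ∃ y', (y, y') ∈ (G : Set (H × H)) := by
    rw [hξ.mem_domain_iff, ξ.scalarMeasure_proj hE]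
    exact (lintegral_mono' Measure.restrict_le_self le_rfl).trans_lt
      ((hξ.mem_domain_iff x).1 ⟨x', hx⟩)
  obtain ⟨z', hyz'⟩ : ∃ z', y' + z' = x' := ⟨x' - y', add_sub_cancel _ _⟩
  have hz : (z, z') ∈ G := by
    simpa [← hyz, ← hyz'] using G.sub_mem hx hy
  have hortho : ⟪y, z'⟫_ℂ = 0 := by
    refine eq_zero_of_unit_mul_add_conj_mul_eq (w' := ⟪z, y'⟫_ℂ) fun c hc => ?_
    have hrotate : ⟪y + c • z, y' + c • z'⟫_ℂ = ⟪y + z, y' + z'⟫_ℂ := by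
      rw [hξ.inner_eq_integral (y + c • z) (y' + c • z') (G.add_mem hy (G.smul_mem c hz)),
        ξ.scalarMeasure_proj_add_unit_smul_proj_compl hE x hc, hyz, hyz',
        hξ.inner_eq_integral _ _ hx]
    have hcc : starRingEnd ℂ c * c = 1 := by simp [Complex.conj_mul', hc]
    simp only [inner_add_left, inner_add_right, inner_smul_left, inner_smul_right] at hrotate
    linear_combination hrotate - ⟪z, z'⟫_ℂ * hcc
  rw [← ξ.scalarMeasure_proj hE, ← hξ.inner_eq_integral _ _ hy, ← hyz', inner_add_right, hortho,
    add_zero]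

theorem IsSpectralMeasure.ae_eq_eigenvalue {G : Submodule ℂ (H × H)}
    {ξ : ProjectionValuedMeasure H} (hξ : IsSpectralMeasure ξ G) {x : H} {c : ℝ}
    (hx : (x, (c : ℂ) • x) ∈ G) : ∀ᵐ t ∂(ξ.scalarMeasure x), t = c := by
  have hint : Integrable (fun t : ℝ => t) (ξ.scalarMeasure x) :=
    integrable_id_of_lintegral_sq_lt_top ((hξ.mem_domain_iff x).1 ⟨_, hx⟩)
  refine Integrable.ae_eq_of_forall_setIntegral_eq _ _ hint (integrable_const _) fun E hE _ => ?_
  have h := hξ.inner_proj_eq_setIntegral hx hE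
  rw [inner_smul_right, ξ.inner_proj_self hE] at h
  rw [setIntegral_const, smul_eq_mul, Measure.real, ξ.scalarMeasure_apply hE,
    ENNReal.toReal_ofReal (by positivity), mul_comm]
  exact_mod_cast h.symm

theorem IsSpectralMeasure.proj_eigenvector {G : Submodule ℂ (H × H)}
    {ξ : ProjectionValuedMeasure H} (hξ : IsSpectralMeasure ξ G) {x : H} {c : ℝ}
    (hx : (x, (c : ℂ) • x) ∈ G) {E : Set ℝ} (hE : MeasurableSet E) :
    ξ.proj E x = E.indicator (fun _ => x) c := by
  have hzero : ∀ F, MeasurableSet F → c ∉ F → ξ.proj F x = 0 := fun F hF hc => by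
    have hnull : ξ.scalarMeasure x F = 0 :=
      measure_mono_null (t := {t | ¬t = c}) (fun t ht h => hc (h ▸ ht))
        (ae_iff.1 (hξ.ae_eq_eigenvalue hx))
    simpa [ξ.scalarMeasure_apply hF] using hnull
  by_cases hc : c ∈ E
  · have h : ξ.proj E x + ξ.proj Eᶜ x = x := congr($(ξ.proj_add_proj_compl hE) x)
    rw [indicator_of_mem hc]
    rwa [hzero _ hE.compl (notMem_compl_iff.2 hc), add_zero] at h
  · rw [hzero E hE hc, indicator_of_notMem hc]

theorem IsSpectralMeasure.scalarMeasure_eq_sum_dirac {e : HilbertBasis α ℂ H} {l : α → ℝ}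
    {ξ : ProjectionValuedMeasure H} (hξ : IsSpectralMeasure ξ (diagonalGraph e l : Set (H × H)))
    (x : H) :
    ξ.scalarMeasure x =
      Measure.sum fun a => ENNReal.ofReal (‖⟪e a, x⟫_ℂ‖ ^ 2) • Measure.dirac (l a) := by
  refine ξ.scalarMeasure_eq_sum_dirac e l (fun E hE x a => ?_) x
  rw [← ξ.inner_proj_left hE,
    hξ.proj_eigenvector (hilbertBasis_mem_diagonalGraph e l a) hE]
  by_cases ha : l a ∈ E <;> simp [ha]

/-- The spectral measure `E ↦ ∑_{l a ∈ E} |e a⟩⟨e a|` of the diagonal operator. -/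
def diagonalPVM (e : HilbertBasis α ℂ H) (l : α → ℝ) : ProjectionValuedMeasure H where
  proj E := basisProj e (l ⁻¹' E)
  isStarProjection _ _ := isStarProjection_basisProj e _
  proj_univ := by
    ext x
    exact ext_inner_hilbertBasis e fun a => by simp [inner_basisProj]
  hasSum_iUnion E _ hd x := by
    rw [preimage_iUnion]
    exact hasSum_basisProj_iUnion e _ (fun m n hmn => (hd hmn).preimage l) x

theorem scalarMeasure_diagonalPVM (e : HilbertBasis α ℂ H) (l : α → ℝ) (x : H) :
    (diagonalPVM e l).scalarMeasure x =
      Measure.sum fun a => ENNReal.ofReal (‖⟪e a, x⟫_ℂ‖ ^ 2) • Measure.dirac (l a) :=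
  (diagonalPVM e l).scalarMeasure_eq_sum_dirac e l (fun _ _ x a => inner_basisProj e _ x a) x

theorem lintegral_sq_scalarMeasure_diagonalPVM (e : HilbertBasis α ℂ H) (l : α → ℝ) (x : H) :
    ∫⁻ t, ENNReal.ofReal (t ^ 2) ∂(diagonalPVM e l).scalarMeasure x =
      ∑' a, ENNReal.ofReal (‖(l a : ℂ) * ⟪e a, x⟫_ℂ‖ ^ 2) := by
  rw [scalarMeasure_diagonalPVM, lintegral_sum_measure]
  refine tsum_congr fun a => ?_
  rw [lintegral_smul_measure, lintegral_dirac, smul_eq_mul, ← ENNReal.ofReal_mul (by positivity),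
    norm_mul, mul_pow, Complex.norm_real, Real.norm_eq_abs, sq_abs, mul_comm]

theorem isSpectralMeasure_diagonalPVM (e : HilbertBasis α ℂ H) (l : α → ℝ) :
    IsSpectralMeasure (diagonalPVM e l) (diagonalGraph e l : Set (H × H)) := by
  have hdom (x : H) : (∃ y, (x, y) ∈ diagonalGraph e l) ↔
      ∫⁻ t, ENNReal.ofReal (t ^ 2) ∂(diagonalPVM e l).scalarMeasure x < ∞ := by
    rw [lintegral_sq_scalarMeasure_diagonalPVM]
    constructor
    · rintro ⟨y, hy⟩
      simp only [← mk_mem_diagonalGraph.1 hy _, tsum_ofReal_norm_inner_sq]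
      exact ENNReal.ofReal_lt_top
    · intro h
      simp only [mk_mem_diagonalGraph]
      refine exists_forall_inner_eq e ((ENNReal.summable_toReal h.ne).congr fun a => ?_)
      exact ENNReal.toReal_ofReal (by positivity)
  refine ⟨hdom, fun x y hxy => ?_⟩
  have hint := integrable_id_of_lintegral_sq_lt_top ((hdom x).1 ⟨y, hxy⟩)
  rw [scalarMeasure_diagonalPVM] at hint ⊢
  have hsum := (hasSum_integral_measure hint).mapL Complex.ofRealCLM
  refine (e.hasSum_inner_mul_inner x y).unique (hsum.congr_fun fun a => ?_)
  rw [mk_mem_diagonalGraph.1 hxy a, Complex.ofRealCLM_apply, integral_smul_measure, integral_dirac,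
    ENNReal.toReal_ofReal (by positivity), ← inner_conj_symm x, mul_left_comm, Complex.conj_mul',
    smul_eq_mul, mul_comm]
  norm_cast

theorem scalarMeasure_spectralMeasure_diagonalGraph (e : HilbertBasis α ℂ H) (l : α → ℝ) (x : H) :
    (spectralMeasure (diagonalGraph e l : Set (H × H))).scalarMeasure x =
      Measure.sum fun a => ENNReal.ofReal (‖⟪e a, x⟫_ℂ‖ ^ 2) • Measure.dirac (l a) :=
  IsSpectralMeasure.scalarMeasure_eq_sum_dirac
    (Classical.epsilon_spec (p := (IsSpectralMeasure · _)) ⟨_, isSpectralMeasure_diagonalPVM e l⟩) x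

end SpectralMeasure

/-! ### Hilbert–Schmidt operators -/

section HilbertSchmidtBasis

variable {K : Type*} [NormedAddCommGroup K] [InnerProductSpace ℂ K] [CompleteSpace K]
  {ι κ : Type*}

open ContinuousLinearMap (adjoint)

theorem tsum_ofReal_norm_sq_adjoint (u : HilbertBasis ι ℂ K) (v : HilbertBasis κ ℂ K)
    (A : K →L[ℂ] K) :
    ∑' i, ENNReal.ofReal (‖A (u i)‖ ^ 2) = ∑' j, ENNReal.ofReal (‖adjoint A (v j)‖ ^ 2) := by
  simp_rw [← tsum_ofReal_norm_inner_sq v (A (u _)),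
    ← tsum_ofReal_norm_inner_sq u (adjoint A (v _))]
  rw [ENNReal.tsum_comm]
  simp_rw [ContinuousLinearMap.adjoint_inner_right, norm_inner_symm]

theorem mem_hilbertSchmidtSubmodule_iff {A : K →L[ℂ] K} :
    A ∈ hilbertSchmidtSubmodule K ↔ ∑' i, ENNReal.ofReal (‖A (stdBasis K i)‖ ^ 2) ≠ ∞ :=
  ⟨Summable.tsum_ofReal_ne_top, fun h => (ENNReal.summable_toReal h).congr fun i =>
    ENNReal.toReal_ofReal (by positivity)⟩

theorem adjoint_mem_hilbertSchmidtSubmodule {A : K →L[ℂ] K} (hA : A ∈ hilbertSchmidtSubmodule K) :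
    adjoint A ∈ hilbertSchmidtSubmodule K := by
  rw [mem_hilbertSchmidtSubmodule_iff] at hA ⊢
  rwa [← tsum_ofReal_norm_sq_adjoint (stdBasis K)]

theorem mul_mem_hilbertSchmidtSubmodule_left {A : K →L[ℂ] K} (B : K →L[ℂ] K)
    (hA : A ∈ hilbertSchmidtSubmodule K) : B * A ∈ hilbertSchmidtSubmodule K := by
  have hA' : Summable fun i => ‖A (stdBasis K i)‖ ^ 2 := hA
  refine Summable.of_nonneg_of_le (fun i => by positivity) (fun i => ?_) (hA'.mul_left (‖B‖ ^ 2))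
  rw [← mul_pow]
  exact pow_le_pow_left₀ (norm_nonneg _) (B.le_opNorm _) 2

theorem mul_mem_hilbertSchmidtSubmodule_right {A : K →L[ℂ] K} (B : K →L[ℂ] K)
    (hA : A ∈ hilbertSchmidtSubmodule K) : A * B ∈ hilbertSchmidtSubmodule K := by
  have h := adjoint_mem_hilbertSchmidtSubmodule (mul_mem_hilbertSchmidtSubmodule_left
    (adjoint B) (adjoint_mem_hilbertSchmidtSubmodule hA))
  simpa only [← ContinuousLinearMap.star_eq_adjoint, star_mul, star_star] using h

theorem inner_eq_trace_adjoint_mul (A B : HilbertSchmidt K) :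
    ⟪A, B⟫_ℂ = trace (adjoint A.op * B.op) :=
  tsum_congr fun _ => (ContinuousLinearMap.adjoint_inner_right _ _ _).symm

/-- The rank one operator `|x⟩⟨y|` as a Hilbert–Schmidt operator. -/
def rankOneHS (x y : K) : HilbertSchmidt K where
  op := InnerProductSpace.rankOne ℂ x y
  mem := by
    refine ((hasSum_norm_inner_sq (stdBasis K) y).summable.mul_left (‖x‖ ^ 2)).congr fun i => ?_
    rw [InnerProductSpace.rankOne_apply, norm_smul, mul_pow, norm_inner_symm, mul_comm]

theorem inner_rankOneHS (x y : K) (A : HilbertSchmidt K) :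
    ⟪rankOneHS x y, A⟫_ℂ = ⟪x, A.op y⟫_ℂ := by
  rw [HilbertSchmidt.inner_def, ← ContinuousLinearMap.adjoint_inner_left,
    ← (stdBasis K).tsum_inner_mul_inner]
  simp only [rankOneHS, InnerProductSpace.rankOne_apply, inner_smul_left, inner_conj_symm,
    ContinuousLinearMap.adjoint_inner_left, mul_comm]

theorem orthonormal_rankOneHS {u : ι → K} {v : κ → K} (hu : Orthonormal ℂ u)
    (hv : Orthonormal ℂ v) : Orthonormal ℂ fun a : ι × κ => rankOneHS (u a.1) (v a.2) := by
  classical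
  rw [orthonormal_iff_ite]
  rintro ⟨i, j⟩ ⟨i', j'⟩
  rw [inner_rankOneHS, rankOneHS, InnerProductSpace.rankOne_apply, inner_smul_right,
    orthonormal_iff_ite.1 hu, orthonormal_iff_ite.1 hv]
  by_cases h1 : i = i' <;> by_cases h2 : j = j' <;> simp [h1, h2, eq_comm]

/-- The Hilbert basis `|uᵢ⟩⟨vⱼ|` of the Hilbert–Schmidt operators. -/
def rankOneBasis (u : HilbertBasis ι ℂ K) (v : HilbertBasis κ ℂ K) :
    HilbertBasis (ι × κ) ℂ (HilbertSchmidt K) :=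
  HilbertBasis.mkOfOrthogonalEqBot (orthonormal_rankOneHS u.orthonormal v.orthonormal) (by
    refine (Submodule.eq_bot_iff _).2 fun A hA => HilbertSchmidt.op_injective <|
      continuousLinearMap_ext_hilbertBasis v fun j => ext_inner_hilbertBasis u fun i => ?_
    rw [← inner_rankOneHS,
      (Submodule.mem_orthogonal _ A).1 hA _ (Submodule.subset_span ⟨(i, j), rfl⟩)]
    exact (inner_zero_right _).symm)

theorem rankOneBasis_apply (u : HilbertBasis ι ℂ K) (v : HilbertBasis κ ℂ K) (a : ι × κ) :
    rankOneBasis u v a = rankOneHS (u a.1) (v a.2) :=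
  congrFun (HilbertBasis.coe_mkOfOrthogonalEqBot _ _) a

theorem inner_rankOneBasis (u : HilbertBasis ι ℂ K) (v : HilbertBasis κ ℂ K) (a : ι × κ)
    (A : HilbertSchmidt K) : ⟪rankOneBasis u v a, A⟫_ℂ = ⟪u a.1, A.op (v a.2)⟫_ℂ := by
  rw [rankOneBasis_apply, inner_rankOneHS]

end HilbertSchmidtBasis

/-! ### States and their eigenvectors -/

section States

variable {K : Type*} [NormedAddCommGroup K] [InnerProductSpace ℂ K]

theorem apply_eq_smul_of_isPositive {A : K →L[ℂ] K} (hA : A.IsPositive) {c : ℝ} (hc : 0 ≤ c)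
    {x : K} (hx : A (A x) = ((c ^ 2 : ℝ) : ℂ) • x) : A x = (c : ℂ) • x := by
  set w := A x - (c : ℂ) • x with hw
  have hAw : A w = -((c : ℂ) • w) := by
    rw [hw, map_sub, map_smul, hx, smul_sub, smul_smul, neg_sub, Complex.ofReal_pow, sq]
  have hcw : (c : ℂ) • w = 0 := by
    have h : 0 ≤ -(c * ‖w‖ ^ 2) := by
      have := hA.re_inner_nonneg_right w
      rwa [hAw, inner_neg_right, inner_smul_right, inner_self_eq_norm_sq_to_K, map_neg,
        RCLike.re_to_complex, Complex.re_ofReal_mul, ← RCLike.re_to_complex, ← RCLike.ofReal_pow,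
        RCLike.ofReal_re] at this
    have h' : c * ‖w‖ ^ 2 = 0 := by linarith [mul_nonneg hc (sq_nonneg ‖w‖)]
    simpa using h'
  refine sub_eq_zero.1 (inner_self_eq_zero (𝕜 := ℂ) |>.1 ?_)
  calc ⟪w, w⟫_ℂ = ⟪x, A w⟫_ℂ - ⟪x, (c : ℂ) • w⟫_ℂ := by
        rw [← hA.inner_left_eq_inner_right, inner_smul_right, ← Complex.conj_ofReal c,
          ← inner_smul_left, ← inner_sub_left]
    _ = 0 := by rw [hAw, hcw, neg_zero, inner_zero_right, sub_zero]

variable [CompleteSpace K]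

namespace DensityOperator

variable (ρ : DensityOperator K)

theorem sqrt_isPositive : ρ.sqrt.IsPositive :=
  (ContinuousLinearMap.nonneg_iff_isPositive _).1 (CFC.sqrt_nonneg ρ.op)

theorem sqrt_mul_sqrt : ρ.sqrt * ρ.sqrt = ρ.op :=
  CFC.sqrt_mul_sqrt_self ρ.op ((ContinuousLinearMap.nonneg_iff_isPositive _).2 ρ.isPositive)

theorem adjoint_sqrt : ContinuousLinearMap.adjoint ρ.sqrt = ρ.sqrt :=
  ρ.sqrt_isPositive.isSelfAdjoint

theorem suppProj_eq : ρ.suppProj = 1 - ρ.kerProj := Submodule.starProjection_orthogonal' _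

theorem one_sub_suppProj : 1 - ρ.suppProj = ρ.kerProj := by rw [suppProj_eq, sub_sub_cancel]

theorem adjoint_kerProj : ContinuousLinearMap.adjoint ρ.kerProj = ρ.kerProj :=
  isStarProjection_starProjection.isSelfAdjoint

theorem adjoint_suppProj : ContinuousLinearMap.adjoint ρ.suppProj = ρ.suppProj :=
  isStarProjection_starProjection.isSelfAdjoint

end DensityOperator

namespace IsSpectralDecomposition

variable {ι : Type*} {ρ : DensityOperator K} {r : ι → ℝ} {u : HilbertBasis ι ℂ K}

theorem op_apply (h : IsSpectralDecomposition ρ r u) (i : ι) : ρ.op (u i) = (r i : ℂ) • u i := by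
  refine (h.hasSum_apply (u i)).unique ?_
  convert hasSum_single (f := fun j => (r j : ℂ) • ⟪u j, u i⟫_ℂ • u j) i fun j hj => ?_ using 1
  · simp [u.orthonormal.1 i]
  · simp [u.orthonormal.2 hj]

theorem sqrt_apply (h : IsSpectralDecomposition ρ r u) (i : ι) :
    ρ.sqrt (u i) = (√(r i) : ℂ) • u i := by
  refine apply_eq_smul_of_isPositive ρ.sqrt_isPositive (Real.sqrt_nonneg _) ?_
  rw [Real.sq_sqrt (h.nonneg i), ← h.op_apply, ← ρ.sqrt_mul_sqrt, mul_apply_eq_comp]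

theorem kerProj_apply (h : IsSpectralDecomposition ρ r u) (i : ι) :
    ρ.kerProj (u i) = if r i = 0 then u i else 0 := by
  split_ifs with hr
  · rw [DensityOperator.kerProj, Submodule.starProjection_eq_self_iff, LinearMap.mem_ker]
    change ρ.op (u i) = 0
    rw [h.op_apply, hr, Complex.ofReal_zero, zero_smul]
  · rw [DensityOperator.kerProj, Submodule.starProjection_apply_eq_zero_iff,
      Submodule.mem_orthogonal']
    intro x (hx : ρ.op x = 0)
    have h1 := ρ.isPositive.inner_left_eq_inner_right (u i) x
    rw [h.op_apply, hx, inner_zero_right, inner_smul_left] at h1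
    simpa [hr] using h1

theorem suppProj_apply (h : IsSpectralDecomposition ρ r u) (i : ι) :
    ρ.suppProj (u i) = if r i = 0 then 0 else u i := by
  rw [ρ.suppProj_eq, sub_apply, one_apply_eq_self, h.kerProj_apply]
  split_ifs <;> simp

end IsSpectralDecomposition

variable {ι κ : Type*} {ρ σ : DensityOperator K} {r : ι → ℝ} {s : κ → ℝ} {u : HilbertBasis ι ℂ K}
  {v : HilbertBasis κ ℂ K}

theorem norm_inner_sqrt_apply_sq (hσ : IsSpectralDecomposition σ s v) (x : K) (j : κ) :
    ‖⟪x, σ.sqrt (v j)⟫_ℂ‖ ^ 2 = s j * ‖⟪x, v j⟫_ℂ‖ ^ 2 := by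
  rw [hσ.sqrt_apply, inner_smul_right, norm_mul, mul_pow, Complex.norm_real, Real.norm_eq_abs,
    sq_abs, Real.sq_sqrt (hσ.nonneg j)]

theorem hasSum_trace_mul_kerProj (hρ : IsSpectralDecomposition ρ r u)
    (hσ : IsSpectralDecomposition σ s v) :
    HasSum (fun a : ι × κ => if r a.1 = 0 then s a.2 * ‖⟪u a.1, v a.2⟫_ℂ‖ ^ 2 else 0)
      (trace (σ.op * ρ.kerProj)).re := by
  let B : HilbertSchmidt K :=
    ⟨σ.sqrt * ρ.kerProj, mul_mem_hilbertSchmidtSubmodule_right _ σ.sqrt_mem⟩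
  have htrace : ⟪σ.sqrtHS, B⟫_ℂ = trace (σ.op * ρ.kerProj) := by
    rw [inner_eq_trace_adjoint_mul]
    change trace (ContinuousLinearMap.adjoint σ.sqrt * (σ.sqrt * ρ.kerProj)) = _
    rw [σ.adjoint_sqrt, ← mul_assoc, σ.sqrt_mul_sqrt]
  have hsum := Complex.hasSum_re ((rankOneBasis v u).hasSum_inner_mul_inner σ.sqrtHS B)
  rw [htrace, ← (Equiv.prodComm ι κ).hasSum_iff] at hsum
  convert hsum using 2 with ⟨i, j⟩
  change _ = (⟪σ.sqrtHS, rankOneBasis v u (j, i)⟫_ℂ * ⟪rankOneBasis v u (j, i), B⟫_ℂ).re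
  rw [← inner_conj_symm σ.sqrtHS, inner_rankOneBasis, inner_rankOneBasis]
  simp only [DensityOperator.sqrtHS, B, mul_apply_eq_comp, hρ.kerProj_apply]
  split_ifs with hr
  · rw [Complex.conj_mul', ← Complex.ofReal_pow, Complex.ofReal_re, ← norm_inner_sqrt_apply_sq hσ,
      norm_inner_symm, σ.sqrt_isPositive.inner_left_eq_inner_right]
  · simp

end States

/-! ### The relative modular operator -/

section AntidiagonalGraph

variable {H α : Type*} [NormedAddCommGroup H] [InnerProductSpace ℂ H]

/-- The graph, on its maximal domain, of the antilinear operator `e a ↦ l a • e' a`. -/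
def antidiagonalGraph (e e' : HilbertBasis α ℂ H) (l : α → ℝ) : Set (H × H) :=
  {p | ∀ a, ⟪e' a, p.2⟫_ℂ = l a * starRingEnd ℂ ⟪e a, p.1⟫_ℂ}

variable {e e' : HilbertBasis α ℂ H} {l : α → ℝ}

theorem isClosed_antidiagonalGraph : IsClosed (antidiagonalGraph e e' l) := by
  simp only [antidiagonalGraph, ← Set.iInter_ofPred]
  exact isClosed_iInter fun a => isClosed_eq (by fun_prop)
    (continuous_const.mul (Complex.continuous_conj.comp (by fun_prop)))

theorem closure_eq_antidiagonalGraph {G : AddSubmonoid (H × H)}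
    (hG : (G : Set (H × H)) ⊆ antidiagonalGraph e e' l)
    (hbasis : ∀ a (c : ℂ), (c • e a, (l a * starRingEnd ℂ c) • e' a) ∈ G) :
    closure (G : Set (H × H)) = antidiagonalGraph e e' l := by
  refine (closure_minimal hG isClosed_antidiagonalGraph).antisymm fun p hp => ?_
  have hsum := (hasSum_inner_smul e p.1).prodMk (hasSum_inner_smul e' p.2)
  refine mem_closure_of_tendsto hsum (Eventually.of_forall fun t => G.sum_mem fun a _ => ?_)
  rw [hp a]
  exact hbasis a _

theorem antilinearAdjointGraph_eq_antidiagonalGraph {G : Set (H × H)}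
    (hG : G ⊆ antidiagonalGraph e e' l) (hbasis : ∀ a, (e a, (l a : ℂ) • e' a) ∈ G) :
    antilinearAdjointGraph G = antidiagonalGraph e' e l := by
  ext q
  refine ⟨fun hq a => ?_, fun hq p hp => ?_⟩
  · rw [← inner_conj_symm, ← hq _ (hbasis a), inner_smul_right, inner_conj_symm]
  · rw [← e'.tsum_inner_mul_inner, inner_conj_symm, ← e.tsum_inner_mul_inner]
    refine tsum_congr fun a => ?_
    rw [hG hp a, hq a, inner_conj_symm, inner_conj_symm]
    ring

theorem exists_mem_antidiagonalGraph_iff {x y : H} :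
    (∃ b, (x, b) ∈ antidiagonalGraph e e' l ∧ (b, y) ∈ antidiagonalGraph e' e l) ↔
      (x, y) ∈ diagonalGraph e fun a => l a ^ 2 := by
  rw [mk_mem_diagonalGraph]
  constructor
  · rintro ⟨b, hb, hy⟩ a
    rw [hy a, hb a, map_mul, Complex.conj_ofReal, Complex.conj_conj]
    push_cast
    ring
  · intro h
    have hsummable : Summable fun a => ‖(l a : ℂ) * starRingEnd ℂ ⟪e a, x⟫_ℂ‖ ^ 2 := by
      refine Summable.of_nonneg_of_le (fun a => sq_nonneg _) (fun a => ?_)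
        ((hasSum_norm_inner_sq e x).summable.add (hasSum_norm_inner_sq e y).summable)
      rw [h a]
      simp only [norm_mul, mul_pow, Complex.norm_real, RCLike.norm_conj, Real.norm_eq_abs, sq_abs]
      nlinarith [mul_nonneg (sq_nonneg ‖⟪e a, x⟫_ℂ‖) (sq_nonneg (l a ^ 2 - 1)),
        mul_nonneg (sq_nonneg ‖⟪e a, x⟫_ℂ‖) (sq_nonneg (l a))]
    obtain ⟨b, hb⟩ := exists_forall_inner_eq e' hsummable
    refine ⟨b, hb, fun a => ?_⟩
    change ⟪e a, y⟫_ℂ = _ * starRingEnd ℂ ⟪e' a, b⟫_ℂ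
    rw [h a, hb a, map_mul, Complex.conj_ofReal, Complex.conj_conj]
    push_cast
    ring

end AntidiagonalGraph

section ModularOperator

open InnerProductSpace (rankOne comp_rankOne rankOne_comp adjoint_rankOne)

variable {K : Type*} [NormedAddCommGroup K] [InnerProductSpace ℂ K] [CompleteSpace K]
  {ι κ : Type*} {ρ σ : DensityOperator K} {r : ι → ℝ} {s : κ → ℝ} {u : HilbertBasis ι ℂ K}
  {v : HilbertBasis κ ℂ K}

variable (ρ σ) in
/-- The graph of `S` as an additive submonoid. -/
def graphSAddSubmonoid : AddSubmonoid (HilbertSchmidt K × HilbertSchmidt K) where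
  carrier := graphS ρ σ
  zero_mem' := by
    refine ⟨0, 0, ?_, ?_⟩
    · change (0 : K →L[ℂ] K) = 0 * _ + 0 * _
      simp
    · change (0 : K →L[ℂ] K) = _
      simp
  add_mem' := by
    rintro p q ⟨X, Y, hp₁, hp₂⟩ ⟨X', Y', hq₁, hq₂⟩
    refine ⟨X + X', Y + Y', ?_, ?_⟩
    · change p.1.op + q.1.op = _ + (Y.op + Y'.op) * _
      rw [hp₁, hq₁, add_mul, add_mul]
      abel
    · change p.2.op + q.2.op = _
      rw [hp₂, hq₂, map_add, mul_add, add_mul]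

/-- The Hilbert basis `|vⱼ⟩⟨uᵢ|`, indexed like its adjoint `|uᵢ⟩⟨vⱼ|`. -/
def adjointRankOneBasis (u : HilbertBasis ι ℂ K) (v : HilbertBasis κ ℂ K) :
    HilbertBasis (ι × κ) ℂ (HilbertSchmidt K) :=
  HilbertBasis.mk ((rankOneBasis v u).orthonormal.comp Prod.swap Prod.swap_injective) <| by
    rw [Prod.swap_surjective.range_comp, (rankOneBasis v u).dense_span]

theorem adjointRankOneBasis_apply (u : HilbertBasis ι ℂ K) (v : HilbertBasis κ ℂ K) (a : ι × κ) :
    adjointRankOneBasis u v a = rankOneHS (v a.2) (u a.1) := by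
  rw [adjointRankOneBasis, HilbertBasis.coe_mk, Function.comp_apply, rankOneBasis_apply]
  rfl

theorem graphS_subset_antidiagonalGraph (hρ : IsSpectralDecomposition ρ r u)
    (hσ : IsSpectralDecomposition σ s v) :
    graphS ρ σ ⊆ antidiagonalGraph (rankOneBasis u v) (adjointRankOneBasis u v)
      fun a => √(r a.1 / s a.2) := by
  rintro p ⟨X, Y, hp₁, hp₂⟩ ⟨i, j⟩
  rw [inner_rankOneBasis, adjointRankOneBasis_apply, inner_rankOneHS, hp₁, hp₂,
    σ.one_sub_suppProj, ← σ.adjoint_suppProj]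
  dsimp only
  rw [Real.sqrt_div' _ (hσ.nonneg j)]
  simp only [mul_apply_eq_comp, add_apply, hρ.sqrt_apply, hσ.sqrt_apply, hσ.kerProj_apply,
    ContinuousLinearMap.adjoint_inner_right, hσ.suppProj_apply, map_smul,
    inner_smul_right, inner_add_right]
  split_ifs with hs
  · simp [hs]
  · have hs' : ((√(s j) : ℝ) : ℂ) ≠ 0 :=
      Complex.ofReal_ne_zero.2 (Real.sqrt_ne_zero'.2 ((hσ.nonneg j).lt_of_ne' hs))
    rw [← inner_conj_symm (X (v j))]
    simp only [map_zero, inner_zero_right, add_zero, map_mul, Complex.conj_ofReal]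
    push_cast
    field_simp

theorem smul_rankOneHS_mem_graphS (hρ : IsSpectralDecomposition ρ r u)
    (hσ : IsSpectralDecomposition σ s v) (i : ι) (j : κ) (c : ℂ) :
    (c • rankOneHS (u i) (v j),
      (√(r i / s j) * starRingEnd ℂ c) • rankOneHS (v j) (u i)) ∈ graphS ρ σ := by
  rw [Real.sqrt_div' _ (hσ.nonneg j)]
  by_cases hs : s j = 0
  · refine ⟨0, c • rankOneHS (u i) (v j), ?_, ?_⟩
    · change c • rankOne ℂ (u i) (v j) = _ + (c • rankOne ℂ (u i) (v j)) * _
      rw [zero_mul, zero_add, smul_mul_assoc, ContinuousLinearMap.mul_def, rankOne_comp,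
        σ.one_sub_suppProj, σ.adjoint_kerProj, hσ.kerProj_apply, if_pos hs]
    · change (_ : ℂ) • rankOne ℂ (v j) (u i) = _
      simp [hs]
  · have hs' : ((√(s j) : ℝ) : ℂ) ≠ 0 :=
      Complex.ofReal_ne_zero.2 (Real.sqrt_ne_zero'.2 ((hσ.nonneg j).lt_of_ne' hs))
    refine ⟨(c / (√(s j) : ℂ)) • rankOne ℂ (u i) (v j), 0, ?_, ?_⟩
    · change c • rankOne ℂ (u i) (v j) = _ + 0 * _
      rw [zero_mul, add_zero, smul_mul_assoc, ContinuousLinearMap.mul_def, rankOne_comp,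
        σ.adjoint_sqrt, hσ.sqrt_apply, map_smulₛₗ, smul_smul, Complex.conj_ofReal,
        div_mul_cancel₀ _ hs']
    · change (_ : ℂ) • rankOne ℂ (v j) (u i) = _
      rw [map_smulₛₗ, adjoint_rankOne, mul_smul_comm, smul_mul_assoc]
      simp only [ContinuousLinearMap.mul_def]
      rw [comp_rankOne, rankOne_comp, hσ.suppProj_apply, if_neg hs, ρ.adjoint_sqrt, hρ.sqrt_apply,
        map_smulₛₗ, smul_smul, map_div₀, Complex.conj_ofReal, Complex.conj_ofReal]
      push_cast
      congr 1
      ring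

theorem relativeModularGraph_eq_diagonalGraph (hρ : IsSpectralDecomposition ρ r u)
    (hσ : IsSpectralDecomposition σ s v) :
    relativeModularGraph ρ σ = diagonalGraph (rankOneBasis u v) fun a => r a.1 / s a.2 := by
  have hsubset := graphS_subset_antidiagonalGraph hρ hσ
  have hbasis : ∀ a (c : ℂ), (c • rankOneBasis u v a, (√(r a.1 / s a.2) * starRingEnd ℂ c) •
      adjointRankOneBasis u v a) ∈ graphS ρ σ := fun a c => by
    rw [rankOneBasis_apply, adjointRankOneBasis_apply]
    exact smul_rankOneHS_mem_graphS hρ hσ a.1 a.2 c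
  have hclosure := closure_eq_antidiagonalGraph (G := graphSAddSubmonoid ρ σ) hsubset hbasis
  have hadjoint := antilinearAdjointGraph_eq_antidiagonalGraph hsubset fun a => by
    simpa using hbasis a 1
  have hsq : (fun a : ι × κ => r a.1 / s a.2) = fun a => √(r a.1 / s a.2) ^ 2 :=
    funext fun a => (Real.sq_sqrt (div_nonneg (hρ.nonneg a.1) (hσ.nonneg a.2))).symm
  ext ⟨x, y⟩
  rw [hsq, SetLike.mem_coe, ← exists_mem_antidiagonalGraph_iff (e' := adjointRankOneBasis u v),
    ← hclosure, ← hadjoint]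
  rfl

theorem scalarMeasure_relativeModularGraph (hρ : IsSpectralDecomposition ρ r u)
    (hσ : IsSpectralDecomposition σ s v) :
    (spectralMeasure (relativeModularGraph ρ σ)).scalarMeasure σ.sqrtHS =
      Measure.sum fun a : ι × κ =>
        ENNReal.ofReal (s a.2 * ‖⟪u a.1, v a.2⟫_ℂ‖ ^ 2) • Measure.dirac (r a.1 / s a.2) := by
  rw [relativeModularGraph_eq_diagonalGraph hρ hσ, scalarMeasure_spectralMeasure_diagonalGraph]
  simp_rw [inner_rankOneBasis, ← norm_inner_sqrt_apply_sq hσ]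
  rfl

end ModularOperator

/-! ### Extended-real sums and the classical divergence -/

section EReal

variable {α : Type*}

-- No case `∞ - ∞` needs to be excluded, because `⊥` is absorbing for the addition of `EReal`.
theorem coe_ennreal_add_sub_add (p p' n n' : ℝ≥0∞) :
    ((p + p' : ℝ≥0∞) : EReal) - ((n + n' : ℝ≥0∞) : EReal) =
      ((p : EReal) - (n : EReal)) + ((p' : EReal) - (n' : EReal)) := by
  have hneg : -((n : EReal) + n') = -(n : EReal) - n' :=
    EReal.neg_add (.inl (EReal.coe_ennreal_ne_bot _)) (.inr (EReal.coe_ennreal_ne_bot _))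
  simp only [EReal.coe_ennreal_add, sub_eq_add_neg, hneg]
  exact add_add_add_comm _ _ _ _

theorem tsum_toENNReal_add {g h : α → EReal} (hgh : ∀ a, g a = 0 ∨ h a = 0) :
    ∑' a, (g a + h a).toENNReal = ∑' a, (g a).toENNReal + ∑' a, (h a).toENNReal := by
  rw [← ENNReal.tsum_add]
  exact tsum_congr fun a => by rcases hgh a with ha | ha <;> simp [ha]

theorem erealSum_add {g h : α → EReal} (hgh : ∀ a, g a = 0 ∨ h a = 0) :
    erealSum (fun a => g a + h a) = erealSum g + erealSum h := by
  have hneg : ∀ a, -(g a + h a) = -g a + -h a := fun a => by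
    rcases hgh a with ha | ha <;> simp [ha]
  simp only [erealSum, hneg]
  rw [tsum_toENNReal_add hgh, tsum_toENNReal_add fun a => by simpa using hgh a,
    coe_ennreal_add_sub_add]

theorem erealSum_coe_mul {w : α → ℝ} {W : ℝ} (hw : ∀ a, 0 ≤ w a) (hW : HasSum w W) (c : EReal) :
    erealSum (fun a => (w a : EReal) * c) = c * W := by
  have hW0 : 0 ≤ W := hW.nonneg hw
  have hpart (d : EReal) : ((∑' a, ((w a : EReal) * d).toENNReal : ℝ≥0∞) : EReal) =
      W * (d.toENNReal : EReal) := by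
    simp only [EReal.toENNReal_mul (EReal.coe_nonneg.2 (hw _)), EReal.real_coe_toENNReal]
    rw [ENNReal.tsum_mul_right, ← ENNReal.ofReal_tsum_of_nonneg hw hW.summable, hW.tsum_eq,
      EReal.coe_ennreal_mul, EReal.coe_ennreal_ofReal, max_eq_left hW0]
  simp only [erealSum, ← mul_neg, hpart]
  rcases le_total 0 c with hc | hc
  · rw [EReal.coe_toENNReal hc, EReal.toENNReal_of_nonpos (by simpa using hc)]
    simp [mul_comm]
  · rw [EReal.coe_toENNReal (x := -c) (by simpa using hc), EReal.toENNReal_of_nonpos hc]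
    simp [mul_comm]

theorem erealIntegral_restrict_sum_dirac {β : Type*} [MeasurableSpace β]
    [MeasurableSingletonClass β] {s : Set β} [DecidablePred (· ∈ s)] (hs : MeasurableSet s)
    {q : α → ℝ} (hq : ∀ a, 0 ≤ q a) (x : α → β) (g : β → EReal) :
    erealIntegral ((Measure.sum fun a =>
      ENNReal.ofReal (q a) • Measure.dirac (x a)).restrict s) g =
      erealSum (fun a => if x a ∈ s then (q a : EReal) * g (x a) else 0) := by
  have hlintegral (k : β → EReal) : ∫⁻ t, (k t).toENNReal ∂((Measure.sum fun a =>
      ENNReal.ofReal (q a) • Measure.dirac (x a)).restrict s) =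
      ∑' a, (if x a ∈ s then (q a : EReal) * k (x a) else 0).toENNReal := by
    rw [← lintegral_indicator hs, lintegral_sum_measure]
    refine tsum_congr fun a => ?_
    rw [lintegral_smul_measure, lintegral_dirac, smul_eq_mul, indicator_apply]
    split_ifs
    · rw [EReal.toENNReal_mul (EReal.coe_nonneg.2 (hq a)), EReal.real_coe_toENNReal]
    · simp
  have hneg (a : α) : -(if x a ∈ s then (q a : EReal) * g (x a) else 0) =
      if x a ∈ s then (q a : EReal) * -g (x a) else 0 := by
    split_ifs <;> simp
  simp only [erealIntegral, erealSum, hneg, hlintegral g, hlintegral fun t => -g t]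

theorem divergenceTerm_eq_add (f : ℝ → ℝ) {p q : ℝ} (hp : 0 ≤ p) (hq : 0 ≤ q) :
    divergenceTerm f p q = (if 0 < p / q then (q : EReal) * (f (p / q) : EReal) else 0) +
      ((if p = 0 then q else 0 : ℝ) : EReal) * valueAtZero f +
      ((if q = 0 then p else 0 : ℝ) : EReal) * slopeAtInfty f := by
  rcases hp.eq_or_lt with rfl | hp <;> rcases hq.eq_or_lt with rfl | hq
  · simp [divergenceTerm]
  · simp [divergenceTerm, hq.ne']
  · simp [divergenceTerm, hp.ne']
  · simp [divergenceTerm, hp.ne', hq.ne', div_pos hp hq]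

theorem classicalFDivergence_eq_add (f : ℝ → ℝ) {P Q : α → ℝ} (hP : ∀ a, 0 ≤ P a)
    (hQ : ∀ a, 0 ≤ Q a) {W₀ W₁ : ℝ} (hW₀ : HasSum (fun a => if P a = 0 then Q a else 0) W₀)
    (hW₁ : HasSum (fun a => if Q a = 0 then P a else 0) W₁) :
    classicalFDivergence f P Q =
      erealSum (fun a => if 0 < P a / Q a then (Q a : EReal) * (f (P a / Q a) : EReal) else 0) +
        valueAtZero f * W₀ + slopeAtInfty f * W₁ := by
  rw [← erealSum_coe_mul (fun a => by split_ifs <;> simp [hQ a]) hW₀,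
    ← erealSum_coe_mul (fun a => by split_ifs <;> simp [hP a]) hW₁, ← erealSum_add,
    ← erealSum_add, classicalFDivergence]
  · simp only [divergenceTerm_eq_add f (hP _) (hQ _)]
  · intro a
    by_cases ha : Q a = 0 <;> simp [ha]
  · intro a
    by_cases ha : P a = 0 <;> simp [ha]

end EReal

/-! ### Nussbaum–Szkoła distributions -/

section NussbaumSzkolaDistributions

variable {K : Type*} [NormedAddCommGroup K] [InnerProductSpace ℂ K] {ι : Type*} {r s : ι → ℝ}
  {u v : HilbertBasis ι ℂ K}

theorem nussbaumSzkolaP_nonneg (hr : ∀ i, 0 ≤ r i) (a : ι × ι) : 0 ≤ nussbaumSzkolaP r u v a :=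
  mul_nonneg (hr a.1) (sq_nonneg _)

theorem nussbaumSzkolaQ_nonneg (hs : ∀ i, 0 ≤ s i) (a : ι × ι) : 0 ≤ nussbaumSzkolaQ s u v a :=
  mul_nonneg (hs a.2) (sq_nonneg _)

theorem nussbaumSzkolaQ_swap (a : ι × ι) :
    nussbaumSzkolaQ r v u a.swap = nussbaumSzkolaP r u v a := by
  rw [nussbaumSzkolaP, nussbaumSzkolaQ, Prod.fst_swap, Prod.snd_swap, norm_inner_symm]

theorem nussbaumSzkolaP_swap (a : ι × ι) :
    nussbaumSzkolaP s v u a.swap = nussbaumSzkolaQ s u v a := by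
  rw [nussbaumSzkolaP, nussbaumSzkolaQ, Prod.fst_swap, Prod.snd_swap, norm_inner_symm]

theorem nussbaumSzkolaP_div_nussbaumSzkolaQ {a : ι × ι} (ha : nussbaumSzkolaQ s u v a ≠ 0) :
    nussbaumSzkolaP r u v a / nussbaumSzkolaQ s u v a = r a.1 / s a.2 :=
  mul_div_mul_right _ _ (right_ne_zero_of_mul ha)

variable [CompleteSpace K] {ρ σ : DensityOperator K}

theorem hasSum_nussbaumSzkolaQ_of_nussbaumSzkolaP_eq_zero (hρ : IsSpectralDecomposition ρ r u)
    (hσ : IsSpectralDecomposition σ s v) :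
    HasSum (fun a => if nussbaumSzkolaP r u v a = 0 then nussbaumSzkolaQ s u v a else 0)
      (trace (σ.op * ρ.kerProj)).re := by
  refine (hasSum_trace_mul_kerProj hρ hσ).congr_fun fun a => ?_
  by_cases hr : r a.1 = 0 <;> by_cases hw : ⟪u a.1, v a.2⟫_ℂ = 0 <;>
    simp [nussbaumSzkolaP, nussbaumSzkolaQ, hr, hw]

theorem hasSum_nussbaumSzkolaP_of_nussbaumSzkolaQ_eq_zero (hρ : IsSpectralDecomposition ρ r u)
    (hσ : IsSpectralDecomposition σ s v) :
    HasSum (fun a => if nussbaumSzkolaQ s u v a = 0 then nussbaumSzkolaP r u v a else 0)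
      (trace (ρ.op * σ.kerProj)).re := by
  have h := hasSum_nussbaumSzkolaQ_of_nussbaumSzkolaP_eq_zero hσ hρ
  rw [← (Equiv.prodComm ι ι).hasSum_iff] at h
  simpa only [Function.comp_def, Equiv.prodComm_apply, nussbaumSzkolaQ_swap,
    nussbaumSzkolaP_swap] using h

theorem erealIntegral_scalarMeasure_relativeModularGraph (hρ : IsSpectralDecomposition ρ r u)
    (hσ : IsSpectralDecomposition σ s v) (g : ℝ → EReal) :
    erealIntegral (((spectralMeasure (relativeModularGraph ρ σ)).scalarMeasure
      σ.sqrtHS).restrict (Ioi 0)) g =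
      erealSum (fun a => if 0 < nussbaumSzkolaP r u v a / nussbaumSzkolaQ s u v a then
        (nussbaumSzkolaQ s u v a : EReal) *
          g (nussbaumSzkolaP r u v a / nussbaumSzkolaQ s u v a) else 0) := by
  rw [scalarMeasure_relativeModularGraph hρ hσ]
  refine (erealIntegral_restrict_sum_dirac measurableSet_Ioi
    (nussbaumSzkolaQ_nonneg (u := u) (v := v) hσ.nonneg) _ g).trans ?_
  congr 1 with a
  by_cases ha : nussbaumSzkolaQ s u v a = 0
  · simp [ha]
  · simp only [nussbaumSzkolaP_div_nussbaumSzkolaQ ha, mem_Ioi]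

end NussbaumSzkolaDistributions

end NussbaumSzkola

end

/-- Boundary values that do not exist as limits and sums of the form `∞ - ∞` carry the same
conventional value of `EReal` on both sides. -/
theorem theorem3p4_general {K : Type*} [NormedAddCommGroup K] [InnerProductSpace ℂ K]
    [CompleteSpace K] {ι : Type*} (ρ σ : NussbaumSzkola.DensityOperator K)
    (r s : ι → ℝ) (u v : HilbertBasis ι ℂ K)
    (hρ : NussbaumSzkola.IsSpectralDecomposition ρ r u)
    (hσ : NussbaumSzkola.IsSpectralDecomposition σ s v) (f : ℝ → ℝ) :
    NussbaumSzkola.quantumFDivergence f ρ σ =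
      NussbaumSzkola.classicalFDivergence f (NussbaumSzkola.nussbaumSzkolaP r u v)
        (NussbaumSzkola.nussbaumSzkolaQ s u v) := by
  open NussbaumSzkola in
  have hker₀ := hasSum_nussbaumSzkolaQ_of_nussbaumSzkolaP_eq_zero hρ hσ
  have hker₁ := hasSum_nussbaumSzkolaP_of_nussbaumSzkolaQ_eq_zero hρ hσ
  rw [quantumFDivergence, erealIntegral_scalarMeasure_relativeModularGraph hρ hσ,
    classicalFDivergence_eq_add f (nussbaumSzkolaP_nonneg hρ.nonneg)
      (nussbaumSzkolaQ_nonneg hσ.nonneg) hker₀ hker₁]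

theorem theorem3p4 {K : Type*} [NormedAddCommGroup K] [InnerProductSpace ℂ K] [CompleteSpace K]
    {ι : Type*} (ρ σ : NussbaumSzkola.DensityOperator K)
    (r s : ι → ℝ) (u v : HilbertBasis ι ℂ K)
    (hρ : NussbaumSzkola.IsSpectralDecomposition ρ r u)
    (hσ : NussbaumSzkola.IsSpectralDecomposition σ s v)
    (f : ℝ → ℝ) (hf : ConvexOn ℝ (Set.Ioi 0) f ∨ ConcaveOn ℝ (Set.Ioi 0) f) :
    NussbaumSzkola.quantumFDivergence f ρ σ =
      NussbaumSzkola.classicalFDivergence f (NussbaumSzkola.nussbaumSzkolaP r u v)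
        (NussbaumSzkola.nussbaumSzkolaQ s u v) :=
  theorem3p4_general ρ σ r s u v hρ hσ f
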